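/- Topological groups are assumed Hausdorff; "t.d.l.c." means totally disconnected locally compact. A topological group is compactly generated if it is generated by a compact subset. A t.d.l.c. group $G$ is regionally expansive if it has a compactly generated open subgroup $O$ and $O$ has a compact open subgroup $U$ whose normal core $\bigcap_{g\in O} gUg^{-1}$ is trivial. A topological group is monolithic if the intersection of all its non-trivial closed normal subgroups is non-trivial; this intersection is then called its monolith. It is topologically simple if it is non-trivial and its only closed normal subgroups are the trivial subgroup and the whole group. Let $\mathscr{R}$ be the class of robustly monolithic groups, that is, of monolithic t.d.l.c. groups whose monolith (with the subspace topology) is non-discrete, regionally expansive, and topologically simple. Theorem. Let $G$ be a t.d.l.c. group and let $(O_i)_{i\in I}$ be a directed system of compactly generated open subgroups of $G$ (that is, $I$ is a directed preordered set and $O_i\leq O_j$ whenever $i\leq j$) with $\bigcup_{i\in I} O_i = G$. The following are equivalent: (i) $G\in\mathscr{R}$; (ii) there is $i\in I$ such that $O_j\in\mathscr{R}$ for all $j\geq i$. -/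

import Mathlib

/-- A totally disconnected locally compact (t.d.l.c.) group; topological groups are Hausdorff. -/
class IsTDLCGroup (G : Type*) [Group G] [TopologicalSpace G] : Prop extends
  IsTopologicalGroup G, T2Space G, LocallyCompactSpace G, TotallyDisconnectedSpace G

/-- A topological group is compactly generated if some compact subset generates it
as an abstract group. -/
def IsCompactlyGeneratedGroup (G : Type*) [Group G] [TopologicalSpace G] : Prop :=
  ∃ K : Set G, IsCompact K ∧ Subgroup.closure K = ⊤

/-- `G` is regionally expansive: some compactly generated open subgroup `O` has a compact open
subgroup `U` whose normal core in `O` is trivial. -/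
def IsRegionallyExpansive (G : Type*) [Group G] [TopologicalSpace G] : Prop :=
  ∃ O : Subgroup G, IsOpen (O : Set G) ∧ IsCompactlyGeneratedGroup O ∧
    ∃ U : Subgroup O, IsOpen (U : Set O) ∧ IsCompact (U : Set O) ∧ U.normalCore = ⊥

/-- The intersection of all non-trivial closed normal subgroups of `G`. -/
def monolith (G : Type*) [Group G] [TopologicalSpace G] : Subgroup G :=
  sInf {N : Subgroup G | N.Normal ∧ IsClosed (N : Set G) ∧ N ≠ ⊥}

/-- `G` is monolithic: the intersection of all non-trivial closed normal subgroups is non-trivial.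
The trivial group is not monolithic: there the intersection is over the empty family, so it is
the whole (trivial) group. -/
def IsMonolithic (G : Type*) [Group G] [TopologicalSpace G] : Prop :=
  monolith G ≠ ⊥

/-- `G` is topologically simple: it is non-trivial, and its only closed normal subgroups are the
trivial subgroup and `G`. -/
def IsTopologicallySimple (G : Type*) [Group G] [TopologicalSpace G] : Prop :=
  Nontrivial G ∧ ∀ N : Subgroup G, N.Normal → IsClosed (N : Set G) → N = ⊥ ∨ N = ⊤

/-- Robustly monolithic groups: t.d.l.c. groups that are monolithic with non-discrete, regionally
expansive and topologically simple monolith. -/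
structure IsRobustlyMonolithic (G : Type*) [Group G] [TopologicalSpace G] : Prop where
  isTDLCGroup : IsTDLCGroup G
  isMonolithic : IsMonolithic G
  monolith_nondiscrete : ¬ DiscreteTopology (monolith G)
  monolith_regionallyExpansive : IsRegionallyExpansive (monolith G)
  monolith_simple : IsTopologicallySimple (monolith G)

/-! Everything is phrased for subgroups of one ambient group, so that the monoliths of different `O
j` can be compared by inclusion.

The engine is a rigidity property of a non-discrete regionally expansive monolith `M` of a closed
subgroup `H`. An expansive group is generated by a compact open subgroup and finitely many elements,
which may be taken from any dense subgroup. Hence if the elements centralising `M` near the identity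
were dense in `M`, then `M` would be discrete; by minimality `H` contains no such element except 1.
Commutators with small elements of `M` then show that a subgroup normalised by `M` near the identity
and meeting `M` discretely meets `H` trivially (`inf_eq_bot_of_locallyTrivial`).

From the members to `G`: the monoliths of the `O j` increase, the closure of their union is the
monolith of `G`, and rigidity gives its expansiveness and simplicity
(`exists_isRobustMonolith_top`).

From `G` to the members: expansiveness yields one compact set, avoiding 1, that meets all
non-trivial closed normal subgroups of all large `O j`. Commuting pairs of such subgroups in
arbitrarily large `O j` would converge along an ultrafilter to commuting subgroups containing the
monolith of `G`, which is not abelian. So such subgroups intersect non-trivially, and compactness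
gives `O j` a monolith (`exists_isLeastNormal`). These monoliths have dense union in that of `G` and
inherit expansiveness from it. The same limit argument inside them shows that each large one is
itself monolithic, hence simple by minimality. -/

open Filter Topology

/-! ### Relative normality and monoliths inside an ambient group. -/

section Relative

variable {G : Type*} [Group G]

/-- `N` is stable under conjugation by the elements of `H`. -/
def ConjInvariant (H N : Subgroup G) : Prop :=
  ∀ h ∈ H, ∀ n ∈ N, h * n * h⁻¹ ∈ N

theorem ConjInvariant.mono {H H' N : Subgroup G} (h : ConjInvariant H N) (hH : H' ≤ H) :
    ConjInvariant H' N := fun g hg => h g (hH hg)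

theorem ConjInvariant.inf {H N N' : Subgroup G} (h : ConjInvariant H N)
    (h' : ConjInvariant H N') : ConjInvariant H (N ⊓ N') :=
  fun g hg n hn => ⟨h g hg n hn.1, h' g hg n hn.2⟩

theorem conjInvariant_self (H : Subgroup G) : ConjInvariant H H :=
  fun _ hg _ hn => H.mul_mem (H.mul_mem hg hn) (H.inv_mem hg)

theorem conjInvariant_closure {T : Set G} {N : Subgroup G}
    (h : ∀ t ∈ T, ∀ n ∈ N, t * n * t⁻¹ ∈ N ∧ t⁻¹ * n * t ∈ N) :
    ConjInvariant (Subgroup.closure T) N := by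
  intro g hg
  suffices ∀ n ∈ N, g * n * g⁻¹ ∈ N ∧ g⁻¹ * n * g ∈ N from fun n hn => (this n hn).1
  induction hg using Subgroup.closure_induction with
  | mem x hx => exact h x hx
  | one => intro n hn; simpa using hn
  | mul x y _ _ hx hy =>
    intro n hn
    constructor
    · have := (hx _ (hy n hn).1).1
      simpa [mul_assoc] using this
    · have := (hy _ (hx n hn).2).2
      simpa [mul_assoc] using this
  | inv x _ hx =>
    intro n hn
    have := hx n hn
    simpa using this.symm

theorem ConjInvariant.commute_of_disjoint {A B : Subgroup G} (hAB : A ⊓ B = ⊥) {a b : G}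
    (ha : a ∈ A) (hb : b ∈ B) (h₁ : b * a * b⁻¹ ∈ A) (h₂ : a * b * a⁻¹ ∈ B) :
    a * b = b * a := by
  have h : a * b * a⁻¹ * b⁻¹ ∈ A ⊓ B := by
    refine ⟨?_, B.mul_mem h₂ (B.inv_mem hb)⟩
    have : a * b * a⁻¹ * b⁻¹ = a * (b * a * b⁻¹)⁻¹ := by group
    rw [this]
    exact A.mul_mem ha (A.inv_mem h₁)
  rw [hAB, Subgroup.mem_bot] at h
  calc a * b = (a * b * a⁻¹ * b⁻¹) * (b * a) := by group
    _ = b * a := by rw [h, one_mul]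

variable [TopologicalSpace G]

/-- `N` meets some neighbourhood of the identity trivially. -/
def LocallyTrivial (N : Subgroup G) : Prop :=
  ∀ᶠ x in 𝓝 (1 : G), x ∈ N → x = 1

theorem LocallyTrivial.mono {N N' : Subgroup G} (h : LocallyTrivial N) (hN : N' ≤ N) :
    LocallyTrivial N' :=
  Filter.Eventually.mono h fun _ hx hx' => hx (hN hx')

theorem locallyTrivial_bot : LocallyTrivial (⊥ : Subgroup G) :=
  Eventually.of_forall fun _ hx => Subgroup.mem_bot.1 hx

/-- The subgroup of elements that centralise `M` near the identity. -/
def quasiCentralizer (M : Subgroup G) : Subgroup G where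
  carrier := {g | ∀ᶠ x in 𝓝 (1 : G), x ∈ M → g * x = x * g}
  one_mem' := Eventually.of_forall fun x _ => by simp
  mul_mem' := by
    intro a b ha hb
    filter_upwards [ha, hb] with x hxa hxb hx
    rw [mul_assoc, hxb hx, ← mul_assoc, hxa hx, mul_assoc]
  inv_mem' := by
    intro a ha
    filter_upwards [ha] with x hxa hx
    rw [inv_mul_eq_iff_eq_mul, ← mul_assoc, hxa hx, mul_assoc, mul_inv_cancel, mul_one]

theorem mem_quasiCentralizer {M : Subgroup G} {g : G} :
    g ∈ quasiCentralizer M ↔ ∀ᶠ x in 𝓝 (1 : G), x ∈ M → g * x = x * g := Iff.rfl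

/-- `P` is a compactly generated open subgroup of `M` and `U` is a compact open subgroup of `P`
whose core in `P` is trivial. -/
structure ExpansivePair (M P U : Subgroup G) : Prop where
  le : P ≤ M
  le' : U ≤ P
  isCompact : IsCompact (U : Set G)
  isOpen : ∀ᶠ x in 𝓝 (1 : G), x ∈ M → x ∈ U
  compactlyGenerated : ∃ K : Set G, IsCompact K ∧ Subgroup.closure K = P
  core : ∀ Q : Subgroup G, Q ≤ U → ConjInvariant P Q → Q = ⊥

/-- `M` is the smallest non-trivial closed subgroup of `H` that is normal in `H`. -/
structure IsLeastNormal (H M : Subgroup G) : Prop where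
  le : M ≤ H
  isClosed : IsClosed (M : Set G)
  inv : ConjInvariant H M
  ne_bot : M ≠ ⊥
  least : ∀ N : Subgroup G, N ≤ H → IsClosed (N : Set G) → ConjInvariant H N → N ≠ ⊥ → M ≤ N

/-- `H` is monolithic with non-discrete regionally expansive monolith `M`. -/
structure IsExpansiveMonolith (H M : Subgroup G) : Prop extends IsLeastNormal H M where
  not_locallyTrivial : ¬ LocallyTrivial M
  expansive : ∃ P U : Subgroup G, ExpansivePair M P U

/-- `H` is robustly monolithic with monolith `M`. -/
structure IsRobustMonolith (H M : Subgroup G) : Prop extends IsExpansiveMonolith H M where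
  simple : ∀ A : Subgroup G, A ≤ M → IsClosed (A : Set G) → ConjInvariant M A → A = ⊥ ∨ A = M

variable [IsTopologicalGroup G]

theorem eventually_conj {p : G → Prop} (hp : ∀ᶠ x in 𝓝 (1 : G), p x) (g : G) :
    ∀ᶠ x in 𝓝 (1 : G), p (g * x * g⁻¹) := by
  have : Tendsto (fun x : G => g * x * g⁻¹) (𝓝 1) (𝓝 1) := by
    have h : Continuous fun x : G => g * x * g⁻¹ := by fun_prop
    simpa using h.tendsto 1
  exact this.eventually hp

theorem eventually_commutator {p : G → Prop} (hp : ∀ᶠ x in 𝓝 (1 : G), p x) (g : G) :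
    ∀ᶠ x in 𝓝 (1 : G), p (x * g * x⁻¹ * g⁻¹) := by
  have : Tendsto (fun x : G => x * g * x⁻¹ * g⁻¹) (𝓝 1) (𝓝 1) := by
    have h : Continuous fun x : G => x * g * x⁻¹ * g⁻¹ := by fun_prop
    simpa using h.tendsto 1
  exact this.eventually hp

theorem ConjInvariant.topologicalClosure {H N : Subgroup G} (h : ConjInvariant H N) :
    ConjInvariant H N.topologicalClosure := by
  intro g hg n hn
  have hc : Continuous fun x : G => g * x * g⁻¹ := by fun_prop
  exact map_mem_closure (f := fun x : G => g * x * g⁻¹) hc hn fun x hx => h g hg x hx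

/-- The set of elements conjugating a closed subgroup into itself is closed. -/
theorem ConjInvariant.of_subset_closure {D : Set G} {M L : Subgroup G} (hL : IsClosed (L : Set G))
    (hD : ∀ d ∈ D, ∀ n ∈ L, d * n * d⁻¹ ∈ L) (hM : (M : Set G) ⊆ closure D) :
    ConjInvariant M L := by
  intro g hg n hn
  have hc : Continuous fun x : G => x * n * x⁻¹ := by fun_prop
  have := map_mem_closure hc (hM hg) (t := (L : Set G)) fun x hx => hD x hx n hn
  rwa [hL.closure_eq] at this

theorem ConjInvariant.quasiCentralizer {H M : Subgroup G} (h : ConjInvariant H M) :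
    ConjInvariant H (quasiCentralizer M) := by
  intro g hg a ha
  rw [mem_quasiCentralizer] at ha ⊢
  filter_upwards [eventually_conj ha g⁻¹] with x hx hxM
  have h1 := hx (h _ (H.inv_mem hg) x hxM)
  calc g * a * g⁻¹ * x = g * (a * (g⁻¹ * x * g⁻¹⁻¹)) * g⁻¹ := by group
    _ = x * (g * a * g⁻¹) := by rw [h1]; group

/-! ### Consequences of expansiveness. -/

namespace ExpansivePair

variable {M P U : Subgroup G}

/-- By density, finitely many translates of a neighbourhood of 1 by elements of `D` cover a compact
generating set of `P`. A translate that is actually used differs from an element of `P` by an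
element of `U`, so its translating element lies in `P`. -/
theorem exists_finset_closure_eq (h : ExpansivePair M P U) {D : Set G} (hDM : D ⊆ M)
    (hD : (M : Set G) ⊆ closure D) :
    ∃ S : Finset G, (S : Set G) ⊆ D ∩ P ∧ Subgroup.closure ((S : Set G) ∪ U) = P := by
  obtain ⟨K, hK, hKP⟩ := h.compactlyGenerated
  obtain ⟨V, hVU, hV, hV1⟩ := eventually_nhds_iff.1 h.isOpen
  have hKP' : K ⊆ P := hKP ▸ Subgroup.subset_closure
  obtain ⟨T, hT⟩ := hK.elim_finite_subcover (fun d : D => (fun x => (d : G)⁻¹ * x) ⁻¹' V)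
    (fun d => hV.preimage (by fun_prop)) (by
      intro k hk
      have hkc : k ∈ closure D := hD (h.le (hKP' hk))
      obtain ⟨d, hd, hdD⟩ := mem_closure_iff.1 hkc ((fun x => x⁻¹ * k) ⁻¹' V)
        (hV.preimage (by fun_prop)) (by simpa using hV1)
      exact Set.mem_iUnion.2 ⟨⟨d, hdD⟩, hd⟩)
  classical
  let S : Finset G := (T.image Subtype.val).filter (· ∈ P)
  refine ⟨S, ?_, le_antisymm ?_ ?_⟩
  · intro s hs
    simp only [S, Finset.coe_filter, Finset.mem_image, Set.mem_ofPred_eq] at hs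
    obtain ⟨⟨d, _, rfl⟩, hp⟩ := hs
    exact ⟨d.2, hp⟩
  · rw [Subgroup.closure_le]
    rintro x (hx | hx)
    · simp only [S, Finset.coe_filter, Set.mem_ofPred_eq] at hx
      exact hx.2
    · exact h.le' hx
  · rw [← hKP, Subgroup.closure_le]
    intro k hk
    obtain ⟨d, hdT, hd⟩ := Set.mem_iUnion₂.1 (hT hk)
    have hdU : (d : G)⁻¹ * k ∈ U :=
      hVU _ hd (M.mul_mem (M.inv_mem (hDM d.2)) (h.le (hKP' hk)))
    have hdP : (d : G) ∈ P := by
      have := P.mul_mem (hKP' hk) (P.inv_mem (h.le' hdU))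
      simpa using this
    have hdS : (d : G) ∈ S := by
      simp only [S, Finset.mem_filter, Finset.mem_image]
      exact ⟨⟨d, hdT, rfl⟩, hdP⟩
    have h1 : (d : G) ∈ Subgroup.closure ((S : Set G) ∪ U) :=
      Subgroup.subset_closure (Or.inl hdS)
    have h2 : (d : G)⁻¹ * k ∈ Subgroup.closure ((S : Set G) ∪ U) :=
      Subgroup.subset_closure (Or.inr hdU)
    simpa using mul_mem h1 h2

/-- Some compact set avoiding the identity meets all `P`-invariant subgroups meeting `U`
non-trivially. -/
theorem exists_isCompact_meets (h : ExpansivePair M P U) :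
    ∃ C : Set G, IsCompact C ∧ (1 : G) ∉ C ∧ ∀ N : Subgroup G, ConjInvariant P N →
      (∃ x ∈ N, x ∈ U ∧ x ≠ 1) → ∃ c ∈ C, c ∈ N := by
  obtain ⟨S, hSM, hSP⟩ := h.exists_finset_closure_eq (D := M) subset_rfl subset_closure
  obtain ⟨V, hVU, hV, hV1⟩ := eventually_nhds_iff.1 h.isOpen
  -- Conjugation by the generators `s` and their inverses maps `W ∩ M` into `U`. So if `N ∩ U` lay
  -- inside `W`, it would be normalised by `S` and by `U`, hence by `P`, and be trivial.
  let W : Set G := ⋂ s ∈ S, {x | s * x * s⁻¹ ∈ V ∧ s⁻¹ * x * s ∈ V}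
  have hW : IsOpen W := isOpen_biInter_finset fun s _ =>
    (hV.preimage (by fun_prop : Continuous fun x : G => s * x * s⁻¹)).inter
      (hV.preimage (by fun_prop : Continuous fun x : G => s⁻¹ * x * s))
  refine ⟨U \ W, h.isCompact.diff hW, fun h1 => h1.2 ?_, ?_⟩
  · simp [W, hV1]
  intro N hN ⟨x, hxN, hxU, hx1⟩
  by_contra! hC
  refine hx1 ?_
  have hQ : N ⊓ U = ⊥ := by
    refine h.core _ inf_le_right ?_
    rw [← hSP]
    refine conjInvariant_closure ?_
    rintro t (ht | ht) n ⟨hnN, hnU⟩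
    · have htP : t ∈ P := (hSM ht).2
      have hnW : n ∈ W := by
        by_contra hnW
        exact hC n ⟨hnU, hnW⟩ hnN
      have hnM : n ∈ M := h.le (h.le' hnU)
      have htM := h.le htP
      obtain ⟨h1, h2⟩ := Set.mem_iInter₂.1 hnW t ht
      refine ⟨⟨hN t htP n hnN, hVU _ h1 ?_⟩, ?_, hVU _ h2 ?_⟩
      · exact conjInvariant_self M t htM n hnM
      · simpa using hN _ (P.inv_mem htP) n hnN
      · simpa using conjInvariant_self M _ (M.inv_mem htM) n hnM
    · have htP := h.le' ht
      refine ⟨⟨hN t htP n hnN, conjInvariant_self U t ht n hnU⟩, ?_, ?_⟩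
      · simpa using hN _ (P.inv_mem htP) n hnN
      · simpa using conjInvariant_self U _ (U.inv_mem ht) n hnU
  exact Subgroup.mem_bot.1 (hQ ▸ (⟨hxN, hxU⟩ : x ∈ N ⊓ U))

/-- Density allows `P` to be generated by `U` and finitely many elements that commute with all small
elements of `M`. The small elements of `M` then lie in a `P`-invariant subgroup of `U`, which is
trivial. -/
theorem locallyTrivial_of_dense_quasiCentralizer (h : ExpansivePair M P U)
    (hd : (M : Set G) ⊆ closure (M ⊓ quasiCentralizer M : Subgroup G)) : LocallyTrivial M := by
  obtain ⟨S, hSM, hSP⟩ := h.exists_finset_closure_eq (D := (M ⊓ quasiCentralizer M : Subgroup G))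
    (fun x hx => hx.1) hd
  have hS : ∀ᶠ x in 𝓝 (1 : G), x ∈ M → x ∈ U ∧ ∀ s ∈ S, s * x = x * s := by
    have h1 : ∀ᶠ x in 𝓝 (1 : G), ∀ s ∈ S, x ∈ M → s * x = x * s :=
      (Filter.eventually_all_finset S).2 fun s hs => mem_quasiCentralizer.1 (hSM hs).1.2
    filter_upwards [h.isOpen, h1] with x hx hx1 hxM
    exact ⟨hx hxM, fun s hs => hx1 s hs hxM⟩
  -- Asking that all `U`-conjugates commute with `S` makes `Q` normalised by `U` as well as
  -- centralised by `S`.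
  let Q : Subgroup G :=
    { carrier := {x | x ∈ U ∧ ∀ u ∈ U, ∀ s ∈ S, s * (u * x * u⁻¹) = (u * x * u⁻¹) * s}
      one_mem' := ⟨U.one_mem, by simp⟩
      mul_mem' := by
        rintro a b ⟨ha, ha'⟩ ⟨hb, hb'⟩
        refine ⟨U.mul_mem ha hb, fun u hu s hs => ?_⟩
        have e : u * (a * b) * u⁻¹ = (u * a * u⁻¹) * (u * b * u⁻¹) := by group
        have hca : Commute s (u * a * u⁻¹) := ha' u hu s hs
        rw [e]
        exact hca.mul_right (hb' u hu s hs)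
      inv_mem' := by
        rintro a ⟨ha, ha'⟩
        refine ⟨U.inv_mem ha, fun u hu s hs => ?_⟩
        have e : u * a⁻¹ * u⁻¹ = (u * a * u⁻¹)⁻¹ := by group
        have hc : Commute s (u * a * u⁻¹) := ha' u hu s hs
        rw [e]
        exact hc.inv_right }
  have hQ : Q = ⊥ := by
    refine h.core Q (fun x hx => hx.1) ?_
    rw [← hSP]
    refine conjInvariant_closure ?_
    rintro t (ht | ht) n hn
    · have hc : t * n = n * t := by simpa using hn.2 1 U.one_mem t ht
      have e1 : t * n * t⁻¹ = n := by rw [hc]; group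
      have e2 : t⁻¹ * n * t = n := by rw [mul_assoc, ← hc]; group
      rw [e1, e2]
      exact ⟨hn, hn⟩
    · have key : ∀ u ∈ U, u * n * u⁻¹ ∈ Q := by
        intro u hu
        refine ⟨conjInvariant_self U u hu n hn.1, fun v hv s hs => ?_⟩
        have := hn.2 (v * u) (U.mul_mem hv hu) s hs
        simpa [mul_assoc] using this
      exact ⟨key t ht, by simpa using key _ (U.inv_mem ht)⟩
  -- Compactness of `U` makes one neighbourhood of 1 work for all conjugators `u` at once.
  have hev : ∀ᶠ x in 𝓝 (1 : G), ∀ u ∈ (U : Set G), u ∈ U → x ∈ M → ∀ s ∈ S,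
      s * (u * x * u⁻¹) = (u * x * u⁻¹) * s := by
    refine h.isCompact.eventually_forall_of_forall_eventually fun u hu => ?_
    have ht : Tendsto (fun z : G × G => z.2 * z.1 * z.2⁻¹) (𝓝 (1, u)) (𝓝 1) := by
      have hc : Continuous fun z : G × G => z.2 * z.1 * z.2⁻¹ := by fun_prop
      simpa using hc.tendsto (1, u)
    filter_upwards [ht.eventually hS] with z hz hzU hzM
    exact (hz (conjInvariant_self M _ (h.le (h.le' hzU)) _ hzM)).2
  unfold LocallyTrivial
  filter_upwards [h.isOpen, hev] with x hx1 hx2 hxM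
  have : x ∈ Q := ⟨hx1 hxM, fun u hu => hx2 u hu hu hxM⟩
  rwa [hQ, Subgroup.mem_bot] at this

end ExpansivePair

end Relative

/-! ### Rigidity of expansive monoliths. -/

section Relative

variable {G : Type*} [Group G] [TopologicalSpace G] [IsTopologicalGroup G]

namespace IsExpansiveMonolith

variable {H M : Subgroup G}

/-- The intersection is normal in `H`; were it non-trivial, minimality would make it dense in `M`,
and `M` would be discrete. -/
theorem disjoint_quasiCentralizer_self (h : IsExpansiveMonolith H M) :
    M ⊓ quasiCentralizer M = ⊥ := by
  by_contra hne
  obtain ⟨P, U, hPU⟩ := h.expansive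
  refine h.not_locallyTrivial (hPU.locallyTrivial_of_dense_quasiCentralizer ?_)
  refine h.least (M ⊓ quasiCentralizer M).topologicalClosure ?_
    (Subgroup.isClosed_topologicalClosure _) (h.inv.inf h.inv.quasiCentralizer).topologicalClosure ?_
  · exact le_trans (Subgroup.topologicalClosure_minimal _ inf_le_left h.isClosed) h.le
  · exact fun hb => hne (le_bot_iff.1 (hb ▸ Subgroup.le_topologicalClosure _))

variable [T2Space G]

/-- The centraliser of `M` in `H` is closed and normal in `H`; if non-trivial it contains `M`, so
`M` is abelian and lies in its own quasi-centraliser. Commutators then reduce quasi-centralising to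
centralising. -/
theorem disjoint_quasiCentralizer (h : IsExpansiveMonolith H M) (hH : IsClosed (H : Set G)) :
    H ⊓ quasiCentralizer M = ⊥ := by
  have hself := h.disjoint_quasiCentralizer_self
  have hcent : H ⊓ Subgroup.centralizer (M : Set G) = ⊥ := by
    by_contra hne
    have hle : M ≤ H ⊓ Subgroup.centralizer (M : Set G) := by
      refine h.least _ inf_le_left ?_ ?_ hne
      · rw [Subgroup.coe_inf]
        exact hH.inter (Set.isClosed_centralizer _)
      · refine (conjInvariant_self H).inf fun g hg n hn => ?_
        rw [Subgroup.mem_centralizer_iff] at hn ⊢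
        intro m hm
        have := hn _ (h.inv _ (H.inv_mem hg) m hm)
        calc m * (g * n * g⁻¹) = g * ((g⁻¹ * m * g⁻¹⁻¹) * n) * g⁻¹ := by group
          _ = g * n * g⁻¹ * m := by rw [this]; group
    refine h.ne_bot (le_bot_iff.1 (hself ▸ fun x hx => ⟨hx, ?_⟩))
    exact Eventually.of_forall fun y hy => (hle hx).2 y hy |>.symm
  refine le_bot_iff.1 fun g hg => hcent ▸ ⟨hg.1, ?_⟩
  change g ∈ Subgroup.centralizer (M : Set G)
  rw [Subgroup.mem_centralizer_iff]
  intro m hm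
  have hq : m * g * m⁻¹ * g⁻¹ ∈ M ⊓ quasiCentralizer M := by
    constructor
    · have := M.mul_mem hm (h.inv g hg.1 _ (M.inv_mem hm))
      simpa [mul_assoc] using this
    · have h1 := h.inv.quasiCentralizer m (h.le hm) g hg.2
      exact (quasiCentralizer M).mul_mem h1 ((quasiCentralizer M).inv_mem hg.2)
  rw [hself, Subgroup.mem_bot] at hq
  calc m * g = (m * g * m⁻¹ * g⁻¹) * (g * m) := by group
    _ = g * m := by rw [hq, one_mul]

/-- A subgroup that is normalised by a neighbourhood of the identity in the monolith `M` of `H`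
and meets `M` discretely must meet `H` trivially. -/
theorem inf_eq_bot_of_locallyTrivial (h : IsExpansiveMonolith H M) (hH : IsClosed (H : Set G))
    {N : Subgroup G} (hN : ∀ᶠ x in 𝓝 (1 : G), x ∈ M → ∀ n ∈ N, x * n * x⁻¹ ∈ N)
    (ht : LocallyTrivial (N ⊓ M)) : N ⊓ H = ⊥ := by
  have hq := h.disjoint_quasiCentralizer hH
  have hNM : N ⊓ M = ⊥ := by
    -- For small `x` in `M` and `n` in `N ∩ M`, the commutator of `x` and `n` is a small element of
    -- the discrete group `N ∩ M`, hence trivial.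
    refine le_bot_iff.1 fun n hn => hq ▸ ⟨h.le hn.2, ?_⟩
    change n ∈ quasiCentralizer M
    rw [mem_quasiCentralizer]
    filter_upwards [hN, eventually_commutator ht n] with x hx hx' hxM
    have h1 := hx' ⟨N.mul_mem (hx hxM n hn.1) (N.inv_mem hn.1),
      M.mul_mem (conjInvariant_self M x hxM n hn.2) (M.inv_mem hn.2)⟩
    calc n * x = (x * n * x⁻¹ * n⁻¹)⁻¹ * (x * n) := by group
      _ = x * n := by rw [h1]; group
  refine le_bot_iff.1 fun n hn => hq ▸ ⟨hn.2, ?_⟩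
  change n ∈ quasiCentralizer M
  rw [mem_quasiCentralizer]
  filter_upwards [hN] with x hx hxM
  exact ConjInvariant.commute_of_disjoint hNM hn.1 hxM (hx hxM n hn.1) (h.inv n hn.2 x hxM)

end IsExpansiveMonolith

/-! ### Limits of invariant subgroups and existence of a least one. -/

section Limit

variable {I : Type*}

/-- The lower limit of a family of subgroups along a filter. -/
def limSubgroup (F : Filter I) (N : I → Subgroup G) : Subgroup G where
  carrier := {g | ∀ V ∈ 𝓝 g, ∀ᶠ k in F, ∃ x ∈ N k, x ∈ V}
  one_mem' := fun V hV => Eventually.of_forall fun k => ⟨1, (N k).one_mem, mem_of_mem_nhds hV⟩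
  mul_mem' := by
    intro a b ha hb V hV
    have : (fun z : G × G => z.1 * z.2) ⁻¹' V ∈ 𝓝 (a, b) :=
      (continuous_mul.tendsto (a, b)) hV
    obtain ⟨A, hA, B, hB, hAB⟩ := mem_nhds_prod_iff.1 this
    filter_upwards [ha A hA, hb B hB] with k ⟨x, hx, hxA⟩ ⟨y, hy, hyB⟩
    exact ⟨x * y, mul_mem hx hy, hAB (Set.mk_mem_prod hxA hyB)⟩
  inv_mem' := by
    intro a ha V hV
    filter_upwards [ha _ ((continuous_inv.tendsto a) hV)] with k ⟨x, hx, hxV⟩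
    exact ⟨x⁻¹, inv_mem hx, hxV⟩

variable {F : Filter I} {N N' : I → Subgroup G}

theorem mem_limSubgroup {g : G} :
    g ∈ limSubgroup F N ↔ ∀ V ∈ 𝓝 g, ∀ᶠ k in F, ∃ x ∈ N k, x ∈ V := Iff.rfl

theorem isClosed_limSubgroup : IsClosed (limSubgroup F N : Set G) := by
  refine isClosed_of_closure_subset fun g hg V hV => ?_
  obtain ⟨W, hWV, hW, hgW⟩ := mem_nhds_iff.1 hV
  obtain ⟨y, hyW, hy⟩ := mem_closure_iff.1 hg W hW hgW
  exact (hy W (hW.mem_nhds hyW)).mono fun k ⟨x, hx, hxW⟩ => ⟨x, hx, hWV hxW⟩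

theorem limSubgroup_conj_mem {g : G} (hg : ∀ᶠ k in F, ∀ n ∈ N k, g * n * g⁻¹ ∈ N k) :
    ∀ n ∈ limSubgroup F N, g * n * g⁻¹ ∈ limSubgroup F N := by
  intro n hn V hV
  have hc : Continuous fun x : G => g * x * g⁻¹ := by fun_prop
  filter_upwards [hg, hn _ (hc.tendsto n hV)] with k hk ⟨x, hx, hxV⟩
  exact ⟨_, hk x hx, hxV⟩

theorem limSubgroup_le [F.NeBot] {T : Subgroup G} (hT : IsClosed (T : Set G))
    (h : ∀ᶠ k in F, N k ≤ T) : limSubgroup F N ≤ T := by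
  intro g hg
  refine hT.closure_subset (mem_closure_iff_nhds.2 fun V hV => ?_)
  obtain ⟨k, ⟨x, hx, hxV⟩, hk⟩ := ((hg V hV).and h).exists
  exact ⟨x, hxV, hk hx⟩

theorem commute_of_mem_limSubgroup [T2Space G] [F.NeBot]
    (h : ∀ᶠ k in F, ∀ x ∈ N k, ∀ y ∈ N' k, x * y = y * x) {a b : G}
    (ha : a ∈ limSubgroup F N) (hb : b ∈ limSubgroup F N') : a * b = b * a := by
  by_contra hne
  have hopen : IsOpen {z : G × G | z.1 * z.2 ≠ z.2 * z.1} :=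
    isOpen_ne_fun (by fun_prop) (by fun_prop)
  obtain ⟨A, hA, B, hB, hAB⟩ := mem_nhds_prod_iff.1 (hopen.mem_nhds (x := (a, b)) hne)
  obtain ⟨k, hk, ⟨x, hx, hxA⟩, y, hy, hyB⟩ := (h.and ((ha A hA).and (hb B hB))).exists
  exact hAB (Set.mk_mem_prod hxA hyB) (hk x hx y hy)

/-- Points chosen in `C ∩ N k` converge along the ultrafilter by compactness. This keeps limits of
non-trivial subgroups non-trivial when `C` avoids 1. -/
theorem exists_mem_limSubgroup {F : Ultrafilter I} {C : Set G} (hC : IsCompact C)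
    (h : ∀ᶠ k in (F : Filter I), ∃ c ∈ C, c ∈ N k) : ∃ c ∈ C, c ∈ limSubgroup (F : Filter I) N := by
  classical
  let f : I → G := fun k => if hk : ∃ c ∈ C, c ∈ N k then hk.choose else 1
  have hf : ∀ᶠ k in (F : Filter I), f k ∈ C ∧ f k ∈ N k := by
    filter_upwards [h] with k hk
    simp only [f, dif_pos hk]
    exact hk.choose_spec
  obtain ⟨c, hcC, hc⟩ := hC.ultrafilter_le_nhds (F.map f)
    (le_principal_iff.2 (hf.mono fun k hk => hk.1))
  refine ⟨c, hcC, fun V hV => ?_⟩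
  filter_upwards [hf, hc hV] with k hk hkV
  exact ⟨f k, hk.2, hkV⟩

/-- If non-trivial closed invariant subgroups all meet a fixed compact set, and limits of these
contain a non-abelian subgroup `M`, then eventually no two of them commute. -/
theorem exists_forall_not_commute [T2Space G] [Preorder I] [IsDirected I (· ≤ ·)]
    {H : I → Subgroup G} {T M : Subgroup G} {C : Set G} (i₀ : I)
    (hmono : ∀ i j, i₀ ≤ i → i ≤ j → H i ≤ H j) (hT : IsClosed (T : Set G))
    (hHT : ∀ i, i₀ ≤ i → H i ≤ T) (hC : IsCompact C) (hC1 : (1 : G) ∉ C)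
    (hM : ¬ ∀ x ∈ M, ∀ y ∈ M, x * y = y * x)
    (hlim : ∀ L : Subgroup G, L ≤ T → IsClosed (L : Set G) →
      (∀ i, i₀ ≤ i → ConjInvariant (H i) L) → L ≠ ⊥ → M ≤ L)
    (hmeet : ∀ k, i₀ ≤ k → ∀ N : Subgroup G, N ≤ H k → IsClosed (N : Set G) →
      ConjInvariant (H k) N → N ≠ ⊥ → ∃ c ∈ C, c ∈ N) :
    ∃ k₀, i₀ ≤ k₀ ∧ ∀ k, k₀ ≤ k → ∀ N N' : Subgroup G,
      N ≤ H k → IsClosed (N : Set G) → ConjInvariant (H k) N → N ≠ ⊥ →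
      N' ≤ H k → IsClosed (N' : Set G) → ConjInvariant (H k) N' → N' ≠ ⊥ →
      ¬ ∀ x ∈ N, ∀ y ∈ N', x * y = y * x := by
  have : Nonempty I := ⟨i₀⟩
  let good : I → Subgroup G → Prop := fun k N =>
    N ≤ H k ∧ IsClosed (N : Set G) ∧ ConjInvariant (H k) N ∧ N ≠ ⊥
  by_contra! hcon
  have hfreq : ∀ k₀, ∃ k, k₀ ≤ k ∧ ∃ N N' : Subgroup G, good k N ∧ good k N' ∧
      ∀ x ∈ N, ∀ y ∈ N', x * y = y * x := by
    intro k₀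
    obtain ⟨k₁, h0, h1⟩ := exists_ge_ge i₀ k₀
    obtain ⟨k, hk, N, N', a1, a2, a3, a4, b1, b2, b3, b4, hc⟩ := hcon k₁ h0
    exact ⟨k, h1.trans hk, N, N', ⟨a1, a2, a3, a4⟩, ⟨b1, b2, b3, b4⟩, hc⟩
  let bad : Set I := {k | ∃ N N' : Subgroup G, good k N ∧ good k N' ∧
      ∀ x ∈ N, ∀ y ∈ N', x * y = y * x}
  have hne : (atTop ⊓ 𝓟 bad : Filter I).NeBot := by
    refine inf_principal_neBot_iff.2 fun s hs => ?_
    obtain ⟨a, ha⟩ := mem_atTop_sets.1 hs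
    obtain ⟨k, hk, hk'⟩ := hfreq a
    exact ⟨k, ha k hk, hk'⟩
  -- An ultrafilter finer than `atTop` that concentrates on the indices carrying a commuting pair.
  let F : Ultrafilter I := Ultrafilter.of (atTop ⊓ 𝓟 bad)
  have hF : (F : Filter I) ≤ atTop ⊓ 𝓟 bad := Ultrafilter.of_le _
  have hFtop : (F : Filter I) ≤ atTop := hF.trans inf_le_left
  have hFbad : ∀ᶠ k in (F : Filter I), k ∈ bad := (hF.trans inf_le_right) (mem_principal_self _)
  have hbad : ∀ k, ∃ N N' : Subgroup G, k ∈ bad → good k N ∧ good k N' ∧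
      ∀ x ∈ N, ∀ y ∈ N', x * y = y * x := by
    intro k
    by_cases hk : k ∈ bad
    · obtain ⟨N, N', h⟩ := hk
      exact ⟨N, N', fun _ => h⟩
    · exact ⟨⊥, ⊥, fun h => absurd h hk⟩
  choose N N' hNN using hbad
  have hFge : ∀ i, ∀ᶠ k in (F : Filter I), i ≤ k := fun i => hFtop (eventually_ge_atTop i)
  -- The limit is normalised by every `H i`, since `H i ≤ H k` for `k ≥ i`, and is non-trivial
  -- because it meets `C`.
  have key : ∀ N : I → Subgroup G, (∀ᶠ k in (F : Filter I), good k (N k)) →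
      M ≤ limSubgroup (F : Filter I) N := by
    intro N hN
    refine hlim _ (limSubgroup_le hT ?_) isClosed_limSubgroup ?_ ?_
    · filter_upwards [hN, hFge i₀] with k hk hik
      exact hk.1.trans (hHT k hik)
    · intro i hi g hg
      refine limSubgroup_conj_mem ?_
      filter_upwards [hN, hFge i] with k hk hik
      exact hk.2.2.1 g (hmono i k hi hik hg)
    · obtain ⟨c, hcC, hc⟩ := exists_mem_limSubgroup (F := F) (N := N) hC (by
        filter_upwards [hN, hFge i₀] with k hk hik
        exact hmeet k hik _ hk.1 hk.2.1 hk.2.2.1 hk.2.2.2)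
      rintro hb
      rw [hb, Subgroup.mem_bot] at hc
      exact hC1 (hc ▸ hcC)
  refine hM fun x hx y hy => ?_
  refine commute_of_mem_limSubgroup (F := (F : Filter I)) (N := N) (N' := N') ?_
    (key N ?_ hx) (key N' ?_ hy)
  · filter_upwards [hFbad] with k hk using (hNN k hk).2.2
  · filter_upwards [hFbad] with k hk using (hNN k hk).1
  · filter_upwards [hFbad] with k hk using (hNN k hk).2.1

end Limit

-- Two invariant subgroups with trivial intersection commute, so the candidates are closed under
-- finite intersection. Their traces on `C` form a directed family of non-empty compact sets, whose
-- common point is not 1.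
omit [IsTopologicalGroup G] in
theorem exists_isLeastNormal [T2Space G] {H : Subgroup G} {C : Set G}
    (hH : IsClosed (H : Set G)) (hH1 : H ≠ ⊥) (hC : IsCompact C) (hC1 : (1 : G) ∉ C)
    (hmeet : ∀ N : Subgroup G, N ≤ H → IsClosed (N : Set G) →
      ConjInvariant H N → N ≠ ⊥ → ∃ c ∈ C, c ∈ N)
    (hcomm : ∀ N N' : Subgroup G,
      N ≤ H → IsClosed (N : Set G) → ConjInvariant H N → N ≠ ⊥ →
      N' ≤ H → IsClosed (N' : Set G) → ConjInvariant H N' → N' ≠ ⊥ →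
      ¬ ∀ x ∈ N, ∀ y ∈ N', x * y = y * x) :
    ∃ M : Subgroup G, IsLeastNormal H M := by
  let J := {N : Subgroup G // N ≤ H ∧ IsClosed (N : Set G) ∧ ConjInvariant H N ∧ N ≠ ⊥}
  have hJ : Nonempty J := ⟨⟨H, le_rfl, hH, conjInvariant_self H, hH1⟩⟩
  have hdir : Directed (· ⊇ ·) fun N : J => C ∩ (N.1 : Set G) := by
    rintro ⟨A, a1, a2, a3, a4⟩ ⟨B, b1, b2, b3, b4⟩
    have hAB : A ⊓ B ≠ ⊥ := fun hb => hcomm A B a1 a2 a3 a4 b1 b2 b3 b4 fun x hx y hy =>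
      ConjInvariant.commute_of_disjoint hb hx hy (a3 y (b1 hy) x hx) (b3 x (a1 hx) y hy)
    refine ⟨⟨A ⊓ B, inf_le_left.trans a1, ?_, a3.inf b3, hAB⟩, ?_, ?_⟩
    · rw [Subgroup.coe_inf]
      exact a2.inter b2
    · exact Set.inter_subset_inter_right C fun x hx => hx.1
    · exact Set.inter_subset_inter_right C fun x hx => hx.2
  obtain ⟨c, hc⟩ := IsCompact.nonempty_iInter_of_directed_nonempty_isCompact_isClosed
    (fun N : J => C ∩ (N.1 : Set G)) hdir
    (fun ⟨N, a1, a2, a3, a4⟩ => hmeet N a1 a2 a3 a4)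
    (fun N => hC.inter_right N.2.2.1) (fun N => hC.isClosed.inter N.2.2.1)
  rw [Set.mem_iInter] at hc
  refine ⟨⨅ N : J, N.1, iInf_le_of_le hJ.some hJ.some.2.1, ?_, ?_, ?_, ?_⟩
  · rw [Subgroup.coe_iInf]
    exact isClosed_iInter fun N => N.2.2.1
  · intro g hg n hn
    rw [Subgroup.mem_iInf] at hn ⊢
    exact fun N => N.2.2.2.1 g hg n (hn N)
  · intro hb
    have : c ∈ ⨅ N : J, N.1 := Subgroup.mem_iInf.2 fun N => (hc N).2
    rw [hb, Subgroup.mem_bot] at this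
    exact hC1 (this ▸ (hc hJ.some).1)
  · exact fun N a1 a2 a3 a4 => iInf_le (fun N : J => N.1) ⟨N, a1, a2, a3, a4⟩

/-- **Van Dantzig's theorem.** -/
theorem exists_isOpen_isCompact_subgroup [T2Space G] [LocallyCompactSpace G]
    [TotallyDisconnectedSpace G] {W : Set G} (hW : W ∈ 𝓝 (1 : G)) :
    ∃ V : Subgroup G, IsOpen (V : Set G) ∧ IsCompact (V : Set G) ∧ (V : Set G) ⊆ W := by
  obtain ⟨K, hK, hKW, hKc⟩ := local_compact_nhds hW
  obtain ⟨C, hCcl, h1C, hCK⟩ := loc_compact_Haus_tot_disc_of_zero_dim.mem_nhds_iff.1 hK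
  have hCcl : IsClopen C := hCcl
  have hC : IsCompact C := hKc.of_isClosed_subset hCcl.1 hCK
  -- The stabiliser of `C` under left translation: open because `C` is compact and open, and
  -- contained in `C` because `1 ∈ C`.
  let V : Subgroup G :=
    { carrier := {g | ∀ c ∈ C, g * c ∈ C ∧ g⁻¹ * c ∈ C}
      one_mem' := fun c hc => by simpa using hc
      mul_mem' := by
        intro a b ha hb c hc
        refine ⟨?_, ?_⟩
        · simpa [mul_assoc] using (ha _ (hb c hc).1).1
        · simpa [mul_assoc] using (hb _ (ha c hc).2).2
      inv_mem' := by
        intro a ha c hc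
        simpa using (ha c hc).symm }
  have hVC : (V : Set G) ⊆ C := fun g hg => by simpa using (hg 1 h1C).1
  have hV : IsOpen (V : Set G) := by
    refine V.isOpen_of_mem_nhds (g := 1) ?_
    refine hC.eventually_forall_of_forall_eventually (x₀ := (1 : G))
      (P := fun g c => g * c ∈ C ∧ g⁻¹ * c ∈ C) fun c hc => ?_
    have h1 : IsOpen {z : G × G | z.1 * z.2 ∈ C ∧ z.1⁻¹ * z.2 ∈ C} :=
      (hCcl.2.preimage (by fun_prop : Continuous fun z : G × G => z.1 * z.2)).inter
        (hCcl.2.preimage (by fun_prop : Continuous fun z : G × G => z.1⁻¹ * z.2))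
    exact h1.mem_nhds (by simpa using hc)
  exact ⟨V, hV, hC.of_isClosed_subset (V.isClosed_of_isOpen hV) hVC, hVC.trans (hCK.trans hKW)⟩

end Relative

/-! ### From the members of the system to the whole group. -/

section Relative

variable {G : Type*} [Group G] [TopologicalSpace G] [IsTopologicalGroup G]

omit [IsTopologicalGroup G] in
theorem not_locallyTrivial_inf {H N : Subgroup G} (hH : IsOpen (H : Set G))
    (hN : ¬ LocallyTrivial N) : ¬ LocallyTrivial (N ⊓ H) := by
  intro h
  refine hN ?_
  unfold LocallyTrivial at h ⊢
  filter_upwards [h, hH.mem_nhds H.one_mem] with x hx hxH hxN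
  exact hx ⟨hxN, hxH⟩

/-- A non-discrete `N` meets the open subgroup `H` non-trivially, so minimality applies to `N ∩ H`.
This compares the monoliths of nested open subgroups. -/
theorem IsLeastNormal.le_of_not_locallyTrivial {H M N : Subgroup G} (h : IsLeastNormal H M)
    (hH : IsOpen (H : Set G)) (hNc : IsClosed (N : Set G)) (hN : ConjInvariant H N)
    (hN1 : ¬ LocallyTrivial N) : M ≤ N := by
  refine (h.least (N ⊓ H) inf_le_right ?_ (hN.inf (conjInvariant_self H)) ?_).trans inf_le_left
  · rw [Subgroup.coe_inf]
    exact hNc.inter (H.isClosed_of_isOpen hH)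
  · exact fun hb => not_locallyTrivial_inf hH hN1 (hb ▸ locallyTrivial_bot)

theorem IsExpansiveMonolith.not_commutative {H M : Subgroup G} (h : IsExpansiveMonolith H M) :
    ¬ ∀ x ∈ M, ∀ y ∈ M, x * y = y * x := by
  intro hc
  refine h.ne_bot (le_bot_iff.1 (h.disjoint_quasiCentralizer_self ▸ fun x hx => ⟨hx, ?_⟩))
  exact Eventually.of_forall fun y hy => hc x hx y hy

section Directed

variable {I : Type*} [Preorder I] [IsDirected I (· ≤ ·)]

omit [TopologicalSpace G] [IsTopologicalGroup G] in
theorem exists_subgroup_eq_directed_union {M : I → Subgroup G} (i : I)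
    (hM : ∀ j k, i ≤ j → j ≤ k → M j ≤ M k) :
    ∃ L : Subgroup G, ∀ x, x ∈ L ↔ ∃ j, i ≤ j ∧ x ∈ M j := by
  have hJ : Nonempty {j : I // i ≤ j} := ⟨⟨i, le_rfl⟩⟩
  refine ⟨⨆ j : {j : I // i ≤ j}, M j, fun x => ?_⟩
  rw [Subgroup.mem_iSup_of_directed]
  · simp
  · rintro ⟨j, hj⟩ ⟨k, hk⟩
    obtain ⟨l, hjl, hkl⟩ := exists_ge_ge j k
    exact ⟨⟨l, hj.trans hjl⟩, hM j l hj hjl, hM k l hk hkl⟩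

variable {O M : I → Subgroup G}

omit [TopologicalSpace G] [IsTopologicalGroup G] in
theorem conjInvariant_directed_union (hunion : ∀ g, ∃ j, g ∈ O j)
    (hO : ∀ j k, j ≤ k → O j ≤ O k) {i : I} {L : Subgroup G}
    (hinv : ∀ j, i ≤ j → ConjInvariant (O j) (M j))
    (hM : ∀ j k, i ≤ j → j ≤ k → M j ≤ M k)
    (hL : ∀ x, x ∈ L ↔ ∃ j, i ≤ j ∧ x ∈ M j) : ConjInvariant ⊤ L := by
  intro g _ n hn
  obtain ⟨a, ha⟩ := hunion g
  obtain ⟨j, hj, hnj⟩ := (hL n).1 hn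
  obtain ⟨l, hjl, hal⟩ := exists_ge_ge j a
  exact (hL _).2 ⟨l, hj.trans hjl, hinv l (hj.trans hjl) g (hO a l hal ha) n (hM j l hj hjl hnj)⟩

variable [T2Space G] [LocallyCompactSpace G] [TotallyDisconnectedSpace G]

theorem exists_isRobustMonolith_top (hO : ∀ j k, j ≤ k → O j ≤ O k)
    (hopen : ∀ j, IsOpen (O j : Set G)) (hunion : ∀ g, ∃ j, g ∈ O j) (i : I)
    (h : ∀ j, i ≤ j → IsRobustMonolith (O j) (M j)) :
    ∃ M' : Subgroup G, IsRobustMonolith ⊤ M' := by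
  have hcl : ∀ j, IsClosed (O j : Set G) := fun j => (O j).isClosed_of_isOpen (hopen j)
  have hM : ∀ j k, i ≤ j → j ≤ k → M j ≤ M k := fun j k hj hjk =>
    (h j hj).toIsLeastNormal.le_of_not_locallyTrivial (hopen j) (h k (hj.trans hjk)).isClosed
      ((h k (hj.trans hjk)).inv.mono (hO j k hjk)) (h k (hj.trans hjk)).not_locallyTrivial
  obtain ⟨L, hL⟩ := exists_subgroup_eq_directed_union i hM
  have hML : ∀ j, i ≤ j → M j ≤ L.topologicalClosure := fun j hj x hx =>
    L.le_topologicalClosure ((hL x).2 ⟨j, hj, hx⟩)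
  have hLinv : ConjInvariant ⊤ L :=
    conjInvariant_directed_union hunion hO (fun j hj => (h j hj).inv) hM hL
  have hle : ∀ N : Subgroup G, IsClosed (N : Set G) → (∀ j, i ≤ j → M j ≤ N) →
      L.topologicalClosure ≤ N := by
    intro N hN hMN
    refine L.topologicalClosure_minimal (fun x hx => ?_) hN
    obtain ⟨j, hj, hxj⟩ := (hL x).1 hx
    exact hMN j hj hxj
  have hnlt : ¬ LocallyTrivial L.topologicalClosure := fun hlt =>
    (h i le_rfl).not_locallyTrivial (hlt.mono (hML i le_rfl))
  have hOi : ∀ g j, ∃ k, j ≤ k ∧ g ∈ O k := by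
    intro g j
    obtain ⟨a, ha⟩ := hunion g
    obtain ⟨k, hjk, hak⟩ := exists_ge_ge j a
    exact ⟨k, hjk, hO a k hak ha⟩
  refine ⟨L.topologicalClosure, ?_⟩
  refine
    { le := le_top
      isClosed := L.isClosed_topologicalClosure
      inv := hLinv.topologicalClosure
      ne_bot := ?_
      least := ?_
      not_locallyTrivial := hnlt
      expansive := ?_
      simple := ?_ }
  · exact fun hb => hnlt (hb ▸ locallyTrivial_bot)
  · intro N _ hNc hN hN1
    obtain ⟨n, hn, hn1⟩ := N.bot_or_exists_ne_one.resolve_left hN1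
    -- Enlarging the index to `k` puts a non-trivial element of `N` into `O k`, so `N ∩ O k`
    -- contains `M k`.
    refine hle N hNc fun j hj => ?_
    obtain ⟨k, hjk, hnk⟩ := hOi n j
    refine (hM j k hj hjk).trans ?_
    refine ((h k (hj.trans hjk)).least (N ⊓ O k) inf_le_right ?_
      ((hN.mono le_top).inf (conjInvariant_self _)) fun hb => hn1 ?_).trans inf_le_left
    · rw [Subgroup.coe_inf]
      exact hNc.inter (hcl k)
    · exact Subgroup.mem_bot.1 (hb ▸ (⟨hn, hnk⟩ : n ∈ N ⊓ O k))
  · obtain ⟨R, U, hRU⟩ := (h i le_rfl).expansive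
    obtain ⟨V, hVo, hVc, hVs⟩ := exists_isOpen_isCompact_subgroup
      (inter_mem hRU.isOpen ((hopen i).mem_nhds (O i).one_mem))
    obtain ⟨K, hK, hKR⟩ := hRU.compactlyGenerated
    have hVL : IsCompact ((V ⊓ L.topologicalClosure : Subgroup G) : Set G) := by
      rw [Subgroup.coe_inf]
      exact hVc.inter_right L.isClosed_topologicalClosure
    refine ⟨R ⊔ (V ⊓ L.topologicalClosure), V ⊓ L.topologicalClosure,
      ?_⟩
    refine
      { le := sup_le (hRU.le.trans (hML i le_rfl)) inf_le_right
        le' := le_sup_right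
        isCompact := hVL
        isOpen := ?_
        compactlyGenerated := ?_
        core := ?_ }
    · filter_upwards [hVo.mem_nhds V.one_mem] with x hx hxL using ⟨hx, hxL⟩
    · refine ⟨K ∪ (V ⊓ L.topologicalClosure : Subgroup G), hK.union hVL, ?_⟩
      rw [Subgroup.closure_union, hKR, Subgroup.closure_eq]
    -- `V` lies in `O i` and meets `M i` inside `U`. So `Q ∩ M i` is trivial by expansiveness of `M
    -- i`, and rigidity in `O i` kills `Q`.
    · intro Q hQ hQinv
      have hQR : ConjInvariant R Q := hQinv.mono le_sup_left
      have hQM : Q ⊓ M i = ⊥ := hRU.core _ (fun x hx => (hVs (hQ hx.1).1).1 hx.2)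
        (hQR.inf ((conjInvariant_self (M i)).mono hRU.le))
      have hQO : Q ≤ O i := fun x hx => (hVs (hQ hx).1).2
      rw [← (h i le_rfl).inf_eq_bot_of_locallyTrivial (hcl i) (N := Q) ?_
        (hQM ▸ locallyTrivial_bot), inf_eq_left.2 hQO]
      filter_upwards [hRU.isOpen] with x hx hxM using hQR x (hRU.le' (hx hxM))
  · intro A hAL hAc hA
    rw [or_iff_not_imp_left]
    intro hA1
    obtain ⟨a, ha, ha1⟩ := A.bot_or_exists_ne_one.resolve_left hA1
    refine le_antisymm hAL (hle A hAc fun j hj => ?_)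
    obtain ⟨k, hjk, hak⟩ := hOi a j
    have hik := hj.trans hjk
    have hAM : ConjInvariant (M k) A := hA.mono (hML k hik)
    -- By simplicity of `M k`, either `A` contains `M k` or it meets it trivially; rigidity then
    -- excludes the latter, as `a` lies in `A ∩ O k`.
    refine (hM j k hj hjk).trans (inf_eq_right.1 (((h k hik).simple (A ⊓ M k) inf_le_right ?_
      (hAM.inf (conjInvariant_self _))).resolve_left fun hb => ha1 ?_))
    · rw [Subgroup.coe_inf]
      exact hAc.inter (h k hik).isClosed
    · have := (h k hik).inf_eq_bot_of_locallyTrivial (hcl k) (N := A)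
        (Eventually.of_forall fun x hx n hn => hAM x hx n hn) (hb ▸ locallyTrivial_bot)
      exact Subgroup.mem_bot.1 (this ▸ (⟨ha, hak⟩ : a ∈ A ⊓ O k))

end Directed

end Relative

/-! ### From the whole group to large members of the system. -/

section Relative

variable {G : Type*} [Group G] [TopologicalSpace G] [IsTopologicalGroup G]

theorem IsExpansiveMonolith.not_locallyTrivial_inf [T2Space G] {M O N : Subgroup G}
    (h : IsExpansiveMonolith ⊤ M) (hO : IsOpen (O : Set G)) (hN : ConjInvariant O N)
    (hN1 : N ≠ ⊥) : ¬ LocallyTrivial (N ⊓ M) := by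
  intro hlt
  refine hN1 ?_
  rw [← h.inf_eq_bot_of_locallyTrivial isClosed_univ (N := N) ?_ hlt, inf_top_eq]
  filter_upwards [hO.mem_nhds O.one_mem] with x hx _ using hN x hx

omit [IsTopologicalGroup G] in
theorem exists_ne_one_of_not_locallyTrivial {N : Subgroup G} (hN : ¬ LocallyTrivial N)
    {p : G → Prop} (hp : ∀ᶠ x in 𝓝 (1 : G), p x) : ∃ x ∈ N, p x ∧ x ≠ 1 := by
  by_contra! hcon
  refine hN ?_
  unfold LocallyTrivial
  filter_upwards [hp] with x hx hxN using hcon x hxN hx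

theorem IsExpansiveMonolith.expansivePair [T2Space G] {M P U O V : Subgroup G}
    (h : IsExpansiveMonolith ⊤ M) (hPU : ExpansivePair M P U) (hO : IsOpen (O : Set G))
    (hPO : P ≤ O) (hcg : ∃ K : Set G, IsCompact K ∧ Subgroup.closure K = O)
    (hV : IsOpen (V : Set G)) (hVc : IsCompact (V : Set G)) (hVO : V ≤ O) (hVU : V ⊓ M ≤ U) :
    ExpansivePair O O V where
  le := le_rfl
  le' := hVO
  isCompact := hVc
  isOpen := by filter_upwards [hV.mem_nhds V.one_mem] with x hx _ using hx
  compactlyGenerated := hcg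
  core := by
    intro Q hQV hQ
    by_contra hQ1
    refine h.not_locallyTrivial_inf hO hQ hQ1 ?_
    rw [hPU.core (Q ⊓ M) ((inf_le_inf_right M hQV).trans hVU)
      ((hQ.mono hPO).inf (h.inv.mono le_top))]
    exact locallyTrivial_bot

/-- The group generated by `U ∩ M'` and the `U`-conjugates of `S` is compactly generated. The
`U`-conjugates of an invariant subgroup of `U ∩ M'` generate a subgroup of `U` that is normalised by
`S` and `U`, hence by `P`, so it is trivial. -/
theorem ExpansivePair.exists_expansivePair_of_dense {M P U M' : Subgroup G}
    (h : ExpansivePair M P U) (hM' : M' ≤ M) (hc : IsClosed (M' : Set G))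
    (hinv : ConjInvariant U M') {S : Finset G} (hS : (S : Set G) ⊆ M')
    (hSP : Subgroup.closure ((S : Set G) ∪ U) = P) :
    ∃ R : Subgroup G, ExpansivePair M' R (U ⊓ M') := by
  let T : Set G := (fun z : G × G => z.1 * z.2 * z.1⁻¹) '' ((U : Set G) ×ˢ (S : Set G))
  have hT : IsCompact T :=
    (h.isCompact.prod S.finite_toSet.isCompact).image (by fun_prop)
  have hUM : IsCompact ((U ⊓ M' : Subgroup G) : Set G) := by
    rw [Subgroup.coe_inf]
    exact h.isCompact.inter_right hc
  have hTR : T ⊆ Subgroup.closure (T ∪ (U ⊓ M' : Subgroup G)) :=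
    Set.subset_union_left.trans Subgroup.subset_closure
  refine ⟨Subgroup.closure (T ∪ (U ⊓ M' : Subgroup G)),
    { le := ?_
      le' := Set.subset_union_right.trans Subgroup.subset_closure
      isCompact := hUM
      isOpen := ?_
      compactlyGenerated := ⟨_, hT.union hUM, rfl⟩
      core := ?_ }⟩
  · rw [Subgroup.closure_le]
    rintro x (⟨⟨u, s⟩, ⟨hu, hs⟩, rfl⟩ | hx)
    · exact hinv u hu s (hS hs)
    · exact hx.2
  · filter_upwards [h.isOpen] with x hx hxM using ⟨hx (hM' hxM), hxM⟩
  · intro Q hQ hQR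
    let E : Set G := {x | ∃ u ∈ U, ∃ q ∈ Q, u * q * u⁻¹ = x}
    have hEU : ∀ u ∈ U, ∀ x ∈ E, u * x * u⁻¹ ∈ E := by
      rintro u hu _ ⟨v, hv, q, hq, rfl⟩
      exact ⟨u * v, U.mul_mem hu hv, q, hq, by group⟩
    have hES : ∀ s, (s ∈ S ∨ s⁻¹ ∈ S) → ∀ x ∈ E, s * x * s⁻¹ ∈ E := by
      rintro s hs _ ⟨v, hv, q, hq, rfl⟩
      -- Moving `s` past the conjugator `v` turns it into a `U`-conjugate of `s`, which normalises
      -- `Q`.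
      have hsR : v⁻¹ * s * v ∈ Subgroup.closure (T ∪ (U ⊓ M' : Subgroup G)) := by
        rcases hs with hs | hs
        · exact hTR ⟨(v⁻¹, s), ⟨U.inv_mem hv, hs⟩, by simp⟩
        · have : v⁻¹ * s⁻¹ * v ∈ Subgroup.closure (T ∪ (U ⊓ M' : Subgroup G)) :=
            hTR ⟨(v⁻¹, s⁻¹), ⟨U.inv_mem hv, hs⟩, by simp⟩
          simpa [mul_assoc] using inv_mem this
      exact ⟨v, hv, _, hQR _ hsR q hq, by group⟩
    have hE : ∀ t ∈ (S : Set G) ∪ U, ∀ x ∈ E, t * x * t⁻¹ ∈ E ∧ t⁻¹ * x * t ∈ E := by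
      rintro t (ht | ht) x hx
      · exact ⟨hES t (Or.inl ht) x hx, by
          simpa using hES t⁻¹ (Or.inr (by simpa using ht)) x hx⟩
      · exact ⟨hEU t ht x hx, by simpa using hEU t⁻¹ (U.inv_mem ht) x hx⟩
    have hconj : ∀ g : G, (∀ x ∈ E, g * x * g⁻¹ ∈ E) →
        ∀ n ∈ Subgroup.closure E, g * n * g⁻¹ ∈ Subgroup.closure E := by
      intro g hg n hn
      induction hn using Subgroup.closure_induction with
      | mem x hx => exact Subgroup.subset_closure (hg x hx)
      | one => simp
      | mul x y _ _ hx hy =>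
        have := mul_mem hx hy
        simpa [mul_assoc] using this
      | inv x _ hx =>
        have := inv_mem hx
        simpa [mul_assoc] using this
    have hbot : Subgroup.closure E = ⊥ := by
      refine h.core _ ?_ ?_
      · rw [Subgroup.closure_le]
        rintro _ ⟨u, hu, q, hq, rfl⟩
        exact conjInvariant_self U u hu q (hQ hq).1
      · rw [← hSP]
        refine conjInvariant_closure fun t ht n hn => ⟨?_, ?_⟩
        · exact hconj t (fun x hx => (hE t ht x hx).1) n hn
        · simpa using hconj t⁻¹ (fun x hx => by simpa using (hE t ht x hx).2) n hn
    rw [eq_bot_iff, ← hbot]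
    exact fun q hq => Subgroup.subset_closure ⟨1, U.one_mem, q, hq, by simp⟩

/-- A minimal closed normal subgroup is simple as soon as it is itself monolithic. -/
theorem IsLeastNormal.simple_of_isLeastNormal {H M A : Subgroup G} (h : IsLeastNormal H M)
    (hA : IsLeastNormal M A) (B : Subgroup G) (hBM : B ≤ M) (hBc : IsClosed (B : Set G))
    (hB : ConjInvariant M B) : B = ⊥ ∨ B = M := by
  rw [or_iff_not_imp_left]
  intro hB1
  refine le_antisymm hBM (le_trans ?_ (hA.least B hBM hBc hB hB1))
  refine h.least A (hA.le.trans h.le) hA.isClosed ?_ hA.ne_bot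
  intro g hg n hn
  -- The conjugate of `A` by `g⁻¹` is again closed, non-trivial and normal in `M`, so it contains
  -- `A`. Thus `A` is normal in `H`, and minimality of `M` gives `M ≤ A`.
  let A' : Subgroup G := A.comap (MulAut.conj g).toMonoidHom
  have hmem : ∀ x, x ∈ A' ↔ g * x * g⁻¹ ∈ A := fun x => by simp [A']
  suffices A ≤ A' from (hmem n).1 (this hn)
  refine hA.least A' ?_ ?_ ?_ ?_
  · intro x hx
    have := h.inv g⁻¹ (H.inv_mem hg) _ (hA.le ((hmem x).1 hx))
    simpa [mul_assoc] using this
  · exact hA.isClosed.preimage (by fun_prop : Continuous fun x : G => g * x * g⁻¹)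
  · intro m hm x hx
    rw [hmem] at hx ⊢
    have := hA.inv _ (h.inv g hg m hm) _ hx
    simpa [mul_assoc] using this
  · obtain ⟨a, ha, ha1⟩ := A.bot_or_exists_ne_one.resolve_left hA.ne_bot
    intro hb
    have : g⁻¹ * a * g ∈ A' := (hmem _).2 (by simpa [mul_assoc] using ha)
    rw [hb, Subgroup.mem_bot] at this
    refine ha1 ?_
    calc a = g * (g⁻¹ * a * g) * g⁻¹ := by group
      _ = 1 := by rw [this]; group

section Directed

variable {I : Type*} [Preorder I] [IsDirected I (· ≤ ·)] {O : I → Subgroup G}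

omit [IsTopologicalGroup G] in
theorem exists_forall_closure_le [Nonempty I] (hO : ∀ j k, j ≤ k → O j ≤ O k)
    (hopen : ∀ j, IsOpen (O j : Set G)) (hunion : ∀ g, ∃ j, g ∈ O j) {K : Set G}
    (hK : IsCompact K) : ∃ i, ∀ j, i ≤ j → Subgroup.closure K ≤ O j := by
  obtain ⟨i, hi⟩ := hK.elim_directed_cover (fun j => (O j : Set G)) hopen
    (fun x _ => Set.mem_iUnion.2 (hunion x)) (fun j k => by
      obtain ⟨l, hjl, hkl⟩ := exists_ge_ge j k
      exact ⟨l, hO j l hjl, hO k l hkl⟩)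
  exact ⟨i, fun j hij => (Subgroup.closure_le _).2 (hi.trans (hO i j hij))⟩

variable [T2Space G]

/-- Large members of a directed system of expansive open subgroups are monolithic. -/
theorem IsExpansiveMonolith.exists_forall_isLeastNormal {M : Subgroup G}
    (h : IsExpansiveMonolith ⊤ M) (hO : ∀ j k, j ≤ k → O j ≤ O k)
    (hopen : ∀ j, IsOpen (O j : Set G)) (hunion : ∀ g, ∃ j, g ∈ O j) {i : I} {V : Subgroup G}
    (hV : ExpansivePair (O i) (O i) V) :
    ∃ i', i ≤ i' ∧ ∀ k, i' ≤ k → ∃ M' : Subgroup G, IsLeastNormal (O k) M' := by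
  obtain ⟨C, hC, hC1, hCm⟩ := hV.exists_isCompact_meets
  -- The compact set obtained from `O i` serves every larger `O k`: by rigidity in the whole group,
  -- `N` is non-discrete, so it meets `V` non-trivially.
  have hmeet : ∀ k, i ≤ k → ∀ N : Subgroup G, N ≤ O k → IsClosed (N : Set G) →
      ConjInvariant (O k) N → N ≠ ⊥ → ∃ c ∈ C, c ∈ N := by
    intro k hik N _ _ hN hN1
    obtain ⟨x, hx, ⟨hxV, hxO⟩, hx1⟩ := exists_ne_one_of_not_locallyTrivial
      (h.not_locallyTrivial_inf (hopen k) hN hN1)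
      (hV.isOpen.and ((hopen i).mem_nhds (O i).one_mem))
    exact hCm N (hN.mono (hO i k hik)) ⟨x, hx.1, hxV hxO, hx1⟩
  obtain ⟨i', hii', hcomm⟩ := exists_forall_not_commute (H := O) (T := ⊤) i
    (fun j k _ hjk => hO j k hjk) isClosed_univ (fun _ _ => le_top) hC hC1 h.not_commutative
    (fun L hLT hLc hL hL1 => h.least L hLT hLc (fun g _ => by
      obtain ⟨j, hj⟩ := hunion g
      obtain ⟨k, hik, hjk⟩ := exists_ge_ge i j
      exact hL k hik g (hO j k hjk hj)) hL1) hmeet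
  refine ⟨i', hii', fun k hk => exists_isLeastNormal ((O k).isClosed_of_isOpen (hopen k)) ?_ hC hC1
    (hmeet k (hii'.trans hk)) (hcomm k hk)⟩
  intro hb
  refine _root_.not_locallyTrivial_inf (hopen k) h.not_locallyTrivial ?_
  rw [hb, inf_bot_eq]
  exact locallyTrivial_bot

variable [LocallyCompactSpace G] [TotallyDisconnectedSpace G]

theorem IsRobustMonolith.exists_forall_isRobustMonolith [Nonempty I] {M₀ : Subgroup G}
    (h : IsRobustMonolith ⊤ M₀) (hO : ∀ j k, j ≤ k → O j ≤ O k)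
    (hopen : ∀ j, IsOpen (O j : Set G)) (hunion : ∀ g, ∃ j, g ∈ O j)
    (hcg : ∀ i, ∃ K : Set G, IsCompact K ∧ Subgroup.closure K = O i) :
    ∃ i, ∀ j, i ≤ j → ∃ M : Subgroup G, IsRobustMonolith (O j) M := by
  have hcl : ∀ j, IsClosed (O j : Set G) := fun j => (O j).isClosed_of_isOpen (hopen j)
  have hE := h.toIsExpansiveMonolith
  obtain ⟨P, U, hPU⟩ := h.expansive
  obtain ⟨K, hK, hKP⟩ := hPU.compactlyGenerated
  obtain ⟨i₀, hi₀⟩ := exists_forall_closure_le hO hopen hunion hK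
  rw [hKP] at hi₀
  obtain ⟨V, hV, hVc, hVs⟩ := exists_isOpen_isCompact_subgroup
    (inter_mem hPU.isOpen ((hopen i₀).mem_nhds (O i₀).one_mem))
  obtain ⟨i₁, hi₁, hleast⟩ := hE.exists_forall_isLeastNormal hO hopen hunion
    (hE.expansivePair hPU (hopen i₀) (hi₀ i₀ le_rfl) (hcg i₀) hV hVc (fun x hx => (hVs hx).2)
      fun x hx => (hVs hx.1).1 hx.2)
  have hM' : ∀ k, ∃ M' : Subgroup G, i₁ ≤ k → IsLeastNormal (O k) M' := by
    intro k
    by_cases hk : i₁ ≤ k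
    · obtain ⟨M', hM'⟩ := hleast k hk
      exact ⟨M', fun _ => hM'⟩
    · exact ⟨⊥, fun h => absurd h hk⟩
  choose M hM using hM'
  have hnlt : ∀ k, i₁ ≤ k → ¬ LocallyTrivial (M k) := fun k hk hlt =>
    hE.not_locallyTrivial_inf (hopen k) (hM k hk).inv (hM k hk).ne_bot (hlt.mono inf_le_left)
  have hMM₀ : ∀ k, i₁ ≤ k → M k ≤ M₀ := fun k hk =>
    (hM k hk).le_of_not_locallyTrivial (hopen k) h.isClosed (h.inv.mono le_top)
      h.not_locallyTrivial
  have hmono : ∀ j k, i₁ ≤ j → j ≤ k → M j ≤ M k := fun j k hj hjk =>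
    (hM j hj).le_of_not_locallyTrivial (hopen j) (hM k (hj.trans hjk)).isClosed
      ((hM k (hj.trans hjk)).inv.mono (hO j k hjk)) (hnlt k (hj.trans hjk))
  obtain ⟨D, hD⟩ := exists_subgroup_eq_directed_union i₁ hmono
  have hDinv : ConjInvariant ⊤ D :=
    conjInvariant_directed_union hunion hO (fun j hj => (hM j hj).inv) hmono hD
  have hMD : ∀ j, i₁ ≤ j → M j ≤ D := fun j hj x hx => (hD x).2 ⟨j, hj, hx⟩
  have hDdense : (M₀ : Set G) ⊆ closure (D : Set G) := by
    refine h.least D.topologicalClosure le_top D.isClosed_topologicalClosure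
      hDinv.topologicalClosure fun hb => (hM i₁ le_rfl).ne_bot (le_bot_iff.1 ?_)
    exact hb ▸ (hMD i₁ le_rfl).trans D.le_topologicalClosure
  have hDM₀ : D ≤ M₀ := by
    intro x hx
    obtain ⟨j, hj, hxj⟩ := (hD x).1 hx
    exact hMM₀ j hj hxj
  obtain ⟨S, hSD, hSP⟩ := hPU.exists_finset_closure_eq hDM₀ hDdense
  -- `S` is finite and lies in the directed union `D`, so a single `M i₂` contains it; this makes
  -- every later `M k` expansive.
  obtain ⟨i₂, hi₂, hSi₂⟩ : ∃ i₂, i₁ ≤ i₂ ∧ (S : Set G) ⊆ M i₂ := by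
    have hsub : ∀ s ∈ S, ∃ j, i₁ ≤ j ∧ s ∈ M j := fun s hs => (hD s).1 (hSD hs).1
    clear hSP hSD
    classical
    induction S using Finset.induction_on with
    | empty => exact ⟨i₁, le_rfl, by simp⟩
    | insert a S _ ih =>
      obtain ⟨j, hj, hSj⟩ := ih fun s hs => hsub s (Finset.mem_insert_of_mem hs)
      obtain ⟨l, hl, hal⟩ := hsub a (Finset.mem_insert_self a S)
      obtain ⟨m, hjm, hlm⟩ := exists_ge_ge j l
      refine ⟨m, hj.trans hjm, ?_⟩
      rw [Finset.coe_insert, Set.insert_subset_iff]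
      exact ⟨hmono l m hl hlm hal, hSj.trans (hmono j m hj hjm)⟩
  have hEk : ∀ k, i₂ ≤ k → IsExpansiveMonolith (O k) (M k) := by
    intro k hk
    have hk₁ := hi₂.trans hk
    obtain ⟨R, hR⟩ := hPU.exists_expansivePair_of_dense (hMM₀ k hk₁) (hM k hk₁).isClosed
      ((hM k hk₁).inv.mono (hPU.le'.trans (hi₀ k (hi₁.trans hk₁))))
      (hSi₂.trans (hmono i₂ k hi₂ hk)) hSP
    exact { toIsLeastNormal := hM k hk₁, not_locallyTrivial := hnlt k hk₁, expansive := ⟨R, _, hR⟩ }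
  obtain ⟨R, W, hRW⟩ := (hEk i₂ le_rfl).expansive
  obtain ⟨C, hC, hC1, hCm⟩ := hRW.exists_isCompact_meets
  have hmeet : ∀ k, i₂ ≤ k → ∀ A : Subgroup G, A ≤ M k → IsClosed (A : Set G) →
      ConjInvariant (M k) A → A ≠ ⊥ → ∃ c ∈ C, c ∈ A := by
    intro k hk A hAM _ hA hA1
    have hA₂ : ConjInvariant (M i₂) A := hA.mono (hmono i₂ k hi₂ hk)
    -- Rigidity is used twice: in `O i₂` it gives `A ∩ O i₂ = 1`, so `A` is discrete; in `O k` it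
    -- then makes `A` trivial.
    have hnt : ¬ LocallyTrivial (A ⊓ M i₂) := by
      intro hlt
      have hb := (hEk i₂ le_rfl).inf_eq_bot_of_locallyTrivial (hcl i₂) (N := A)
        (Eventually.of_forall fun x hx n hn => hA₂ x hx n hn) hlt
      have hAlt : LocallyTrivial A := by
        by_contra hAlt
        exact not_locallyTrivial_inf (hopen i₂) hAlt (hb ▸ locallyTrivial_bot)
      refine hA1 ?_
      rw [← (hEk k hk).inf_eq_bot_of_locallyTrivial (hcl k) (N := A)
        (Eventually.of_forall fun x hx n hn => hA x hx n hn) (hAlt.mono inf_le_left),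
        inf_eq_left.2 (hAM.trans (hEk k hk).le)]
    obtain ⟨x, hx, hxW, hx1⟩ := exists_ne_one_of_not_locallyTrivial hnt hRW.isOpen
    exact hCm A (hA₂.mono hRW.le) ⟨x, hx.1, hxW hx.2, hx1⟩
  obtain ⟨i₃, hi₃, hcomm⟩ := exists_forall_not_commute (H := M) (T := M₀) (M := M₀) i₂
    (fun j k hj hjk => hmono j k (hi₂.trans hj) hjk) h.isClosed
    (fun j hj => hMM₀ j (hi₂.trans hj)) hC hC1 hE.not_commutative
    (fun L hLT hLc hL hL1 => by
      -- A limit normalised by all large `M k` is normalised by `D`, hence, being closed, by `M₀`;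
      -- simplicity of `M₀` identifies it.
      refine ((h.simple L hLT hLc ?_).resolve_left hL1).ge
      refine ConjInvariant.of_subset_closure (D := D) hLc (fun d hd => ?_) hDdense
      obtain ⟨j, hj, hdj⟩ := (hD d).1 hd
      obtain ⟨k, hjk, hk⟩ := exists_ge_ge j i₂
      exact hL k hk d (hmono j k hj hjk hdj)) hmeet
  refine ⟨i₃, fun k hk => ⟨M k, { toIsExpansiveMonolith := hEk k (hi₃.trans hk), simple := ?_ }⟩⟩
  have hEk' := hEk k (hi₃.trans hk)
  obtain ⟨A, hA⟩ := exists_isLeastNormal hEk'.isClosed hEk'.ne_bot hC hC1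
    (hmeet k (hi₃.trans hk)) (hcomm k hk)
  exact hEk'.toIsLeastNormal.simple_of_isLeastNormal hA

end Directed

end Relative

/-! ### Translation between intrinsic properties and subgroups of an ambient group. -/

section Embedding

variable {A G : Type*} [Group A] [Group G]

theorem conjInvariant_map {f : A →* G} {N : Subgroup A} (hN : N.Normal) :
    ConjInvariant f.range (N.map f) := by
  rintro _ ⟨a, rfl⟩ _ ⟨n, hn, rfl⟩
  exact ⟨a * n * a⁻¹, hN.conj_mem n hn a, by simp⟩

theorem normal_comap_of_conjInvariant {f : A →* G} {N : Subgroup G}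
    (hN : ConjInvariant f.range N) : (N.comap f).Normal :=
  ⟨fun n hn a => by simpa using hN (f a) ⟨a, rfl⟩ (f n) hn⟩

theorem map_comap_of_le_range {f : A →* G} {N : Subgroup G} (hN : N ≤ f.range) :
    (N.comap f).map f = N := by
  rw [Subgroup.map_comap_eq, inf_eq_right.2 hN]

variable [TopologicalSpace A] [TopologicalSpace G] {f : A →* G}

theorem isRegionallyExpansive_iff [IsTopologicalGroup A] (hf : IsEmbedding f) :
    IsRegionallyExpansive A ↔ ∃ P U : Subgroup G, ExpansivePair f.range P U := by
  constructor
  · rintro ⟨O, hO, ⟨K, hK, hKO⟩, U, hU, hUc, hcore⟩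
    have hfO : Continuous (f.comp O.subtype) := hf.continuous.comp continuous_subtype_val
    refine ⟨O.map f, U.map (f.comp O.subtype),
      { le := Subgroup.map_le_range f O
        le' := ?_
        isCompact := ?_
        isOpen := ?_
        compactlyGenerated := ?_
        core := ?_ }⟩
    · rintro _ ⟨u, _, rfl⟩
      exact ⟨u, u.2, rfl⟩
    · rw [Subgroup.coe_map]
      exact hUc.image hfO
    · have h1 : Subtype.val '' (U : Set O) ∈ 𝓝 (1 : A) :=
        (hO.isOpenMap_subtype_val _ hU).mem_nhds ⟨1, U.one_mem, rfl⟩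
      rw [hf.isInducing.nhds_eq_comap, map_one] at h1
      obtain ⟨W, hW, hWU⟩ := h1
      filter_upwards [hW] with x hxW
      rintro ⟨a, rfl⟩
      obtain ⟨u, hu, hua⟩ := hWU hxW
      exact ⟨u, hu, by simp [hua]⟩
    · refine ⟨f.comp O.subtype '' K, hK.image hfO, ?_⟩
      rw [← MonoidHom.map_closure, hKO, ← MonoidHom.range_eq_map, MonoidHom.range_comp,
        Subgroup.range_subtype]
    · intro Q hQU hQ
      have hN : (Q.comap (f.comp O.subtype)).Normal := by
        refine normal_comap_of_conjInvariant (hQ.mono ?_)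
        rw [MonoidHom.range_comp, Subgroup.range_subtype]
      have hle : Q.comap (f.comp O.subtype) ≤ U.normalCore := by
        refine Subgroup.normal_le_normalCore.2 fun x hx => ?_
        obtain ⟨u, hu, hux⟩ := hQU hx
        rwa [← Subtype.ext (hf.injective hux)]
      rw [hcore] at hle
      refine le_bot_iff.1 fun q hq => ?_
      obtain ⟨u, hu, rfl⟩ := hQU hq
      have : u = 1 := Subgroup.mem_bot.1 (hle hq)
      rw [this, map_one]
      exact Subgroup.one_mem _
  · rintro ⟨P, U, h⟩
    have hUo : (U.comap f : Set A) ∈ 𝓝 (1 : A) := by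
      have h1 := h.isOpen
      rw [← map_one f] at h1
      filter_upwards [hf.continuous.continuousAt.eventually h1] with x hx using hx ⟨x, rfl⟩
    have hOo : IsOpen (U.comap f : Set A) := Subgroup.isOpen_of_mem_nhds _ hUo
    have hi : IsInducing (f.comp (P.comap f).subtype) := hf.isInducing.comp IsInducing.subtypeVal
    have hr : (f.comp (P.comap f).subtype).range = P := by
      rw [MonoidHom.range_comp, Subgroup.range_subtype, map_comap_of_le_range h.le]
    have hinj : Function.Injective (f.comp (P.comap f).subtype) :=
      hf.injective.comp Subtype.val_injective
    have hcomp : ∀ K : Set G, IsCompact K → K ⊆ P →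
        IsCompact (f.comp (P.comap f).subtype ⁻¹' K) := by
      intro K hK hKP
      refine (hi.isCompact_preimage_iff ?_).2 hK
      rwa [← MonoidHom.coe_range, hr]
    refine ⟨P.comap f, Subgroup.isOpen_mono (Subgroup.comap_mono h.le') hOo, ?_,
      U.comap (f.comp (P.comap f).subtype), ?_, hcomp U h.isCompact h.le', ?_⟩
    · obtain ⟨K, hK, hKP⟩ := h.compactlyGenerated
      have hKP' : K ⊆ P := hKP ▸ Subgroup.subset_closure
      refine ⟨_, hcomp K hK hKP', Subgroup.map_injective hinj ?_⟩
      rw [MonoidHom.map_closure, ← MonoidHom.range_eq_map, hr, Set.image_preimage_eq_of_subset, hKP]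
      rwa [← MonoidHom.coe_range, hr]
    · exact hOo.preimage continuous_subtype_val
    · refine Subgroup.map_injective hinj ?_
      rw [Subgroup.map_bot]
      refine h.core _ (Subgroup.map_le_iff_le_comap.2 (Subgroup.normalCore_le _)) ?_
      have := conjInvariant_map (f := f.comp (P.comap f).subtype)
        (Subgroup.normalCore_normal (U.comap (f.comp (P.comap f).subtype)))
      rwa [hr] at this

theorem locallyTrivial_range_iff [IsTopologicalGroup A] (hf : IsEmbedding f) :
    LocallyTrivial f.range ↔ DiscreteTopology A := by
  constructor
  · intro h
    refine discreteTopology_of_isOpen_singleton_one (isOpen_singleton_iff_nhds_eq_pure _ |>.2 ?_)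
    refine le_antisymm (le_pure_iff.2 ?_) (pure_le_nhds 1)
    unfold LocallyTrivial at h
    rw [← map_one f] at h
    filter_upwards [hf.continuous.continuousAt.eventually h] with x hx
    exact hf.injective ((hx ⟨x, rfl⟩))
  · intro h
    have h1 : ({1} : Set A) ∈ 𝓝 (1 : A) := (isOpen_discrete _).mem_nhds rfl
    rw [hf.isInducing.nhds_eq_comap, map_one] at h1
    obtain ⟨W, hW, hW1⟩ := h1
    unfold LocallyTrivial
    filter_upwards [hW] with x hxW
    rintro ⟨a, rfl⟩
    rw [show a = 1 from hW1 hxW, map_one]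

theorem isTopologicallySimple_iff (hf : IsClosedEmbedding f) :
    IsTopologicallySimple A ↔ f.range ≠ ⊥ ∧ ∀ B : Subgroup G, B ≤ f.range →
      IsClosed (B : Set G) → ConjInvariant f.range B → B = ⊥ ∨ B = f.range := by
  have hinj := Subgroup.map_injective hf.injective
  have hne : Nontrivial A ↔ f.range ≠ ⊥ := by
    rw [MonoidHom.range_eq_map, Ne, Subgroup.map_eq_bot_iff_of_injective _ hf.injective,
      ← Subgroup.nontrivial_iff (G := A)]
    exact ⟨fun _ => bot_ne_top.symm, fun h => ⟨⟨_, _, h⟩⟩⟩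
  rw [IsTopologicallySimple, hne]
  refine and_congr_right fun _ => ⟨fun h B hB hBc hBi => ?_, fun h N hN hNc => ?_⟩
  · rcases h _ (normal_comap_of_conjInvariant hBi) (hBc.preimage hf.continuous) with hb | hb
    · left
      rw [← map_comap_of_le_range hB, hb, Subgroup.map_bot]
    · right
      rw [← map_comap_of_le_range hB, hb, MonoidHom.range_eq_map]
  · rcases h _ (Subgroup.map_le_range f N) (hf.isClosedMap _ hNc) (conjInvariant_map hN) with hb | hb
    · left
      rwa [Subgroup.map_eq_bot_iff_of_injective _ hf.injective] at hb
    · right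
      exact hinj (by rw [hb, MonoidHom.range_eq_map])

theorem isClosed_monolith : IsClosed (monolith A : Set A) := by
  rw [monolith, Subgroup.coe_sInf]
  exact isClosed_biInter fun N hN => hN.2.1

theorem normal_monolith : (monolith A).Normal := by
  refine ⟨fun n hn g => ?_⟩
  rw [monolith, Subgroup.mem_sInf] at hn ⊢
  exact fun N hN => hN.1.conj_mem n (hn N hN) g

theorem isLeastNormal_map_monolith (hf : IsClosedEmbedding f) (h : IsMonolithic A) :
    IsLeastNormal f.range ((monolith A).map f) where
  le := Subgroup.map_le_range _ _
  isClosed := hf.isClosedMap _ isClosed_monolith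
  inv := conjInvariant_map normal_monolith
  ne_bot := fun hb => h ((Subgroup.map_eq_bot_iff_of_injective _ hf.injective).1 hb)
  least := by
    intro N hN hNc hNi hN1
    rw [Subgroup.map_le_iff_le_comap]
    refine sInf_le ⟨normal_comap_of_conjInvariant hNi, hNc.preimage hf.continuous, fun hb => hN1 ?_⟩
    rw [← map_comap_of_le_range hN, hb, Subgroup.map_bot]

theorem IsLeastNormal.map_monolith (hf : IsClosedEmbedding f) {M : Subgroup G}
    (h : IsLeastNormal f.range M) : (monolith A).map f = M := by
  refine le_antisymm ?_ ?_
  · rw [Subgroup.map_le_iff_le_comap]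
    refine sInf_le ⟨normal_comap_of_conjInvariant h.inv, h.isClosed.preimage hf.continuous,
      fun hb => h.ne_bot ?_⟩
    rw [← map_comap_of_le_range h.le, hb, Subgroup.map_bot]
  · rw [← map_comap_of_le_range h.le]
    refine Subgroup.map_mono (le_sInf fun N hN => ?_)
    refine (Subgroup.map_le_map_iff_of_injective hf.injective).1 ?_
    rw [map_comap_of_le_range h.le]
    exact h.least _ (Subgroup.map_le_range _ _) (hf.isClosedMap _ hN.2.1) (conjInvariant_map hN.1)
      fun hb => hN.2.2 ((Subgroup.map_eq_bot_iff_of_injective _ hf.injective).1 hb)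

/-- The closed embedding carries closed normal subgroups to closed invariant ones and back, so the
monolith maps to the least one. The other conditions transfer along the embedding of the monolith,
which is again closed. -/
theorem isRobustlyMonolithic_iff (hA : IsTDLCGroup A) (hf : IsClosedEmbedding f) :
    IsRobustlyMonolithic A ↔ ∃ M : Subgroup G, IsRobustMonolith f.range M := by
  have := hA.toIsTopologicalGroup
  have hg : IsClosedEmbedding (f.comp (monolith A).subtype) :=
    hf.comp isClosed_monolith.isClosedEmbedding_subtypeVal
  have hr : (f.comp (monolith A).subtype).range = (monolith A).map f := by
    rw [MonoidHom.range_comp, Subgroup.range_subtype]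
  have hd := locallyTrivial_range_iff hg.isEmbedding
  have he := isRegionallyExpansive_iff hg.isEmbedding
  have hs := isTopologicallySimple_iff hg
  rw [hr] at hd he hs
  constructor
  · intro h
    exact ⟨(monolith A).map f,
      { toIsLeastNormal := isLeastNormal_map_monolith hf h.isMonolithic
        not_locallyTrivial := fun hl => h.monolith_nondiscrete (hd.1 hl)
        expansive := he.1 h.monolith_regionallyExpansive
        simple := (hs.1 h.monolith_simple).2 }⟩
  · rintro ⟨M, h⟩
    obtain rfl := h.map_monolith hf
    exact
      { isTDLCGroup := hA
        isMonolithic := fun hb => h.ne_bot (by rw [hb, Subgroup.map_bot])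
        monolith_nondiscrete := fun hl => h.not_locallyTrivial (hd.2 hl)
        monolith_regionallyExpansive := he.2 h.expansive
        monolith_simple := hs.2 ⟨h.ne_bot, h.simple⟩ }

end Embedding

theorem isTDLCGroup_subgroup {G : Type*} [Group G] [TopologicalSpace G] [IsTDLCGroup G]
    {H : Subgroup G} (hH : IsClosed (H : Set G)) : IsTDLCGroup H where
  toLocallyCompactSpace := hH.isClosedEmbedding_subtypeVal.locallyCompactSpace

theorem IsCompactlyGeneratedGroup.exists_closure_eq {G : Type*} [Group G] [TopologicalSpace G]
    {H : Subgroup G} (h : IsCompactlyGeneratedGroup H) :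
    ∃ K : Set G, IsCompact K ∧ Subgroup.closure K = H := by
  obtain ⟨K, hK, hKH⟩ := h
  refine ⟨H.subtype '' K, hK.image continuous_subtype_val, ?_⟩
  rw [← MonoidHom.map_closure, hKH, ← MonoidHom.range_eq_map, Subgroup.range_subtype]

theorem mainTheorem2 {G : Type*} [Group G] [TopologicalSpace G] [IsTDLCGroup G]
    {I : Type*} [Preorder I] [IsDirected I (· ≤ ·)]
    (O : I → Subgroup G) (hmono : ∀ i j : I, i ≤ j → O i ≤ O j)
    (hopen : ∀ i, IsOpen (O i : Set G)) (hcg : ∀ i, IsCompactlyGeneratedGroup (O i))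
    (hunion : (⋃ i, (O i : Set G)) = Set.univ) :
    IsRobustlyMonolithic G ↔ ∃ i : I, ∀ j : I, i ≤ j → IsRobustlyMonolithic (O j) := by
  have hunion' : ∀ g, ∃ j, g ∈ O j := fun g =>
    Set.mem_iUnion.1 (hunion ▸ Set.mem_univ g : g ∈ ⋃ i, (O i : Set G))
  have : Nonempty I := ⟨(hunion' 1).choose⟩
  have hG : IsRobustlyMonolithic G ↔ ∃ M : Subgroup G, IsRobustMonolith ⊤ M := by
    have := isRobustlyMonolithic_iff (f := MonoidHom.id G) inferInstance IsClosedEmbedding.id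
    rwa [MonoidHom.range_eq_top.2 Function.surjective_id] at this
  have hOj : ∀ j, IsRobustlyMonolithic (O j) ↔ ∃ M : Subgroup G, IsRobustMonolith (O j) M := by
    intro j
    have hc := (O j).isClosed_of_isOpen (hopen j)
    have := isRobustlyMonolithic_iff (f := (O j).subtype) (isTDLCGroup_subgroup hc)
      hc.isClosedEmbedding_subtypeVal
    rwa [Subgroup.range_subtype] at this
  simp only [hG, hOj]
  constructor
  · rintro ⟨M, hM⟩
    exact hM.exists_forall_isRobustMonolith hmono hopen hunion' fun i => (hcg i).exists_closure_eq
  · rintro ⟨i, hi⟩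
    choose! M hM using hi
    exact exists_isRobustMonolith_top hmono hopen hunion' i hM
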